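/- Let $G=(V,E)$ be a graph with countable vertex set and finite maximum degree $\Delta(G)=\sup_{v}\deg(v)<\infty$. For $S\subset V$ and $v\in V$ let $\deg_S(v)$ be the number of neighbours of $v$ in $S$. We say that $G$ has the shrink property if every non-empty finite set $S\subset V$ contains a vertex $u$ with $\deg_{V\setminus S}(u)\ge \deg_S(u)$. For $p\in[0,1]$, the $I(G,p)$-model is the right-continuous Markov process $(\sigma_t)_{t\ge 0}$ on $\{+1,-1\}^V$ whose initial spins $\sigma_0(v)$, $v\in V$, are independent, equal to $+1$ with probability $p$ and to $-1$ with probability $1-p$, and whose generator acts on functions $f$ depending on finitely many spins by $$(Lf)(\sigma)=\sum_{v\in V}c(v,\sigma)\bigl(f(\sigma^v)-f(\sigma)\bigr),$$ where $\sigma^v$ is $\sigma$ with the spin at $v$ reversed and, with $\Delta\mathcal H_v(\sigma)=2\sum_{u\sim v}\sigma(u)\sigma(v)$, the rate $c(v,\sigma)$ is $0$, $\tfrac12$ or $1$ according to whether $\Delta\mathcal H_v(\sigma)>0$, $=0$ or $<0$. (That the process has this generator is understood in the sense of the martingale problem: for every such $f$, $f(\sigma_t)-f(\sigma_0)-\int_0^t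 (Lf)(\sigma_s)\,ds$ is a martingale for the filtration generated by the process.) The model is of type $\mathcal I$ if almost surely the spin at every vertex flips infinitely often. Theorem. Suppose that $G$ does not have the shrink property. Then for every $p\in[0,1]$ the $I(G,p)$-model is not of type $\mathcal I$. Moreover, for every finite set $S\subset V$ such that $\deg_{V\setminus S}(u)<\deg_S(u)$ for all $u\in S$, $$\mathbb P\bigl(\sigma_t(u)=+1\ \text{for all } u\in S \text{ and all } t\ge 0\bigr)\ \ge\ p^{|S|}.$$ -/

import Mathlib

open MeasureTheory ProbabilityTheory Filter Topology
open scoped NNReal ENNReal unitInterval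

namespace ZeroTempIsing

/-- `degIn G S v` is the number of neighbours of `v` that lie in `S`. -/
noncomputable def degIn {V : Type*} (G : SimpleGraph V) (S : Set V) (v : V) : ℕ :=
  {u | u ∈ S ∧ G.Adj v u}.ncard

/-- The shrink property: every non-empty finite set `S` of vertices contains a vertex that has
at least as many neighbours outside `S` as inside `S`. -/
def HasShrinkProperty {V : Type*} (G : SimpleGraph V) : Prop :=
  ∀ S : Set V, S.Finite → S.Nonempty → ∃ u ∈ S, degIn G S u ≤ degIn G Sᶜ u

/-- Spin configurations: a spin in `{+1, -1}`, the units of `ℤ`, at each vertex. -/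
abbrev Config (V : Type*) : Type _ := V → ℤˣ

/-- The `σ`-algebra of `{+1, -1}` consists of all subsets. -/
instance instDiscreteMeasurableSpaceSpin : DiscreteMeasurableSpace ℤˣ where
  forall_measurableSet s :=
    ⟨Units.val '' s, trivial, Set.preimage_image_eq s Units.val_injective⟩

open Classical in
/-- The configuration `η` with the spin at `v` reversed. -/
noncomputable def flipAt {V : Type*} (η : Config V) (v : V) : Config V :=
  Function.update η v (-η v)

/-- The change of energy `2 ∑_{u ∼ v} η(u) η(v)` caused by reversing the spin at `v`. -/
def energyChange {V : Type*} (G : SimpleGraph V) [G.LocallyFinite] (v : V) (η : Config V) : ℤ :=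
  2 * ∑ u ∈ G.neighborFinset v, (η u : ℤ) * (η v : ℤ)

/-- The zero-temperature flip rate at `v`: `1` if a flip lowers the energy, `1/2` if it leaves
the energy unchanged, `0` if it raises the energy. -/
noncomputable def flipRate {V : Type*} (G : SimpleGraph V) [G.LocallyFinite] (v : V)
    (η : Config V) : ℝ :=
  if 0 < energyChange G v η then 0 else if energyChange G v η = 0 then 1 / 2 else 1

/-- A function of the configuration is local if it depends on finitely many spins only. -/
def IsLocal {V : Type*} (f : Config V → ℝ) : Prop :=
  ∃ A : Finset V, DependsOn f (A : Set V)

/-- The infinitesimal generator `(L f)(η) = ∑_v c(v, η) (f(η^v) - f(η))`. For a local function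
`f` only finitely many terms are non-zero. -/
noncomputable def generator {V : Type*} (G : SimpleGraph V) [G.LocallyFinite]
    (f : Config V → ℝ) (η : Config V) : ℝ :=
  ∑ᶠ v : V, flipRate G v η * (f (flipAt η v) - f η)

/-- The filtration generated by a process `X`. -/
def pastFiltration {Ω V : Type*} [mΩ : MeasurableSpace Ω] (X : ℝ≥0 → Ω → Config V)
    (hX : ∀ t, Measurable (X t)) : Filtration ℝ≥0 mΩ where
  seq t := ⨆ s ≤ t, MeasurableSpace.comap (X s) inferInstance
  mono' _ _ hst := biSup_mono fun _ hr => hr.trans hst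
  le' _ := iSup₂_le fun s _ => (hX s).comap_le

/-- `X` is an `I(G, p)`-model on the probability space `(Ω, P)`: a process of spin configurations
whose paths are right continuous, whose initial configuration has the Bernoulli product law of
density `p` (independently at each vertex, `+1` with probability `p` and `-1` with probability
`1 - p`), and which solves the martingale problem for the generator of the zero-temperature
dynamics, i.e. is a Markov process with that generator. -/
structure IsIsingModel {Ω V : Type*} [MeasurableSpace Ω] (G : SimpleGraph V) [G.LocallyFinite]
    (p : I) (P : Measure Ω) (X : ℝ≥0 → Ω → Config V) : Prop where
  measurable : ∀ t, Measurable (X t)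
  right_continuous : ∀ ω t, ContinuousWithinAt (fun s => X s ω) (Set.Ici t) t
  initial_law : P.map (X 0) = Measure.infinitePi fun _ : V => bernoulliMeasure (1 : ℤˣ) (-1) p
  martingale : ∀ f : Config V → ℝ, IsLocal f →
    Martingale
      (fun t ω => f (X t ω) - f (X 0 ω) - ∫ s in (0 : ℝ)..t, generator G f (X s.toNNReal ω))
      (pastFiltration X measurable) P

/-- The set of times `t > 0` at which the spin at `v` flips along the path `x`: just before
time `t` the spin is the opposite of the spin at time `t`. -/
def flipTimes {V : Type*} (x : ℝ≥0 → Config V) (v : V) : Set ℝ≥0 :=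
  {t | 0 < t ∧ ∀ᶠ s in 𝓝[<] t, x s v = -x t v}

/-- A model is of type `𝓘` if almost surely no vertex fixates, that is, almost surely every
vertex flips infinitely often. -/
def IsTypeI {Ω V : Type*} [MeasurableSpace Ω] (P : Measure Ω) (X : ℝ≥0 → Ω → Config V) : Prop :=
  ∀ᵐ ω ∂P, ∀ v, (flipTimes (fun t => X t ω) v).Infinite

end ZeroTempIsing

namespace ZeroTempIsing

/-! If every vertex of a finite set `S` has more neighbours inside `S` than outside, then once `S`
is monochromatic no vertex of `S` can flip. So the indicator `f` of "all of `S` has spin `e`"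
satisfies `L f ≥ 0` (`generator_agreeIndicator_nonneg`), and the martingale problem forces `f` to
stay at its maximum 1 once it starts there (`ae_agree`). Right continuity makes this simultaneous in
time, and the product initial law gives the bound. Failure of the shrink property supplies a
non-empty such `S`; a spin `e` of positive initial mass then gives a frozen `S` with positive
probability. -/

/-- The indicator of the event that all spins in `S` equal `e`. -/
noncomputable def agreeIndicator {V : Type*} (S : Finset V) (e : ℤˣ) : Config V → ℝ :=
  {η | ∀ u ∈ S, η u = e}.indicator 1

lemma isLocal_agreeIndicator {V : Type*} (S : Finset V) (e : ℤˣ) :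
    IsLocal (agreeIndicator S e) := by
  refine ⟨S, fun η ξ h => ?_⟩
  have : (∀ u ∈ S, η u = e) ↔ ∀ u ∈ S, ξ u = e :=
    forall₂_congr fun u hu => by rw [h u hu]
  simp [agreeIndicator, Set.indicator_apply, this]

/-- If `v` has more neighbours inside `S` than outside, then reversing its spin in a configuration
that is constant on `S` raises the energy. -/
lemma energyChange_pos {V : Type*} (G : SimpleGraph V) [G.LocallyFinite] {S : Finset V} {e : ℤˣ}
    {η : Config V} (hη : ∀ u ∈ S, η u = e) {v : V} (hv : v ∈ S)
    (h : degIn G (S : Set V)ᶜ v < degIn G (S : Set V) v) : 0 < energyChange G v η := by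
  classical
  have h1 : degIn G (S : Set V) v = ((G.neighborFinset v).filter (· ∈ S)).card := by
    rw [degIn, ← Set.ncard_coe_finset]
    congr 1
    ext u
    simp [and_comm]
  have h2 : degIn G (S : Set V)ᶜ v = ((G.neighborFinset v).filter (¬ · ∈ S)).card := by
    rw [degIn, ← Set.ncard_coe_finset]
    congr 1
    ext u
    simp [and_comm]
  have h3 : ∑ u ∈ (G.neighborFinset v).filter (· ∈ S), (η u : ℤ) * (η v : ℤ) =
      ((G.neighborFinset v).filter (· ∈ S)).card := by
    rw [Finset.card_eq_sum_ones, Nat.cast_sum]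
    refine Finset.sum_congr rfl fun u hu => ?_
    rw [hη u (Finset.mem_filter.1 hu).2, hη v hv, ← Units.val_mul, Int.units_mul_self]
    simp
  have h4 : -(((G.neighborFinset v).filter (¬ · ∈ S)).card : ℤ) ≤
      ∑ u ∈ (G.neighborFinset v).filter (¬ · ∈ S), (η u : ℤ) * (η v : ℤ) := by
    rw [Finset.card_eq_sum_ones, Nat.cast_sum, ← Finset.sum_neg_distrib]
    refine Finset.sum_le_sum fun u _ => ?_
    rw [← Units.val_mul]
    rcases Int.units_eq_one_or (η u * η v) with h | h <;> simp [h]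
  rw [energyChange, ← Finset.sum_filter_add_sum_filter_not _ (· ∈ S)]
  omega

lemma flipRate_nonneg {V : Type*} (G : SimpleGraph V) [G.LocallyFinite] (v : V) (η : Config V) :
    0 ≤ flipRate G v η := by
  unfold flipRate
  split_ifs <;> norm_num

/-- Where the indicator is 1, flips in `S` have rate 0 and flips off `S` do not change it; where it
is 0, a flip cannot decrease it. -/
lemma generator_agreeIndicator_nonneg {V : Type*} (G : SimpleGraph V) [G.LocallyFinite]
    {S : Finset V} (hS : ∀ u ∈ S, degIn G (S : Set V)ᶜ u < degIn G (S : Set V) u) (e : ℤˣ)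
    (η : Config V) : 0 ≤ generator G (agreeIndicator S e) η := by
  refine finsum_nonneg fun v => ?_
  by_cases hη : ∀ u ∈ S, η u = e
  · by_cases hv : v ∈ S
    · simp [flipRate, energyChange_pos G hη hv (hS v hv)]
    · have : ∀ u ∈ S, flipAt η v u = e := fun u hu => by
        classical
        rw [flipAt, Function.update_of_ne (ne_of_mem_of_not_mem hu hv), hη u hu]
      rw [agreeIndicator, Set.indicator_of_mem (by exact this), Set.indicator_of_mem (by exact hη)]
      simp
  · refine mul_nonneg (flipRate_nonneg G v η) ?_
    nth_rw 2 [agreeIndicator]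
    rw [Set.indicator_of_notMem (by exact hη), sub_zero]
    exact Set.indicator_nonneg (fun _ _ => zero_le_one) _

lemma measurableSet_agree {V : Type*} (S : Finset V) (e : ℤˣ) :
    MeasurableSet {η : Config V | ∀ u ∈ S, η u = e} := by
  have : {η : Config V | ∀ u ∈ S, η u = e} = ⋂ u ∈ S, (fun η : Config V => η u) ⁻¹' {e} := by
    ext; simp
  rw [this]
  exact S.measurableSet_biInter fun u _ => measurable_pi_apply u (MeasurableSet.of_discrete)

section Model

variable {V Ω : Type*} [MeasurableSpace Ω] {G : SimpleGraph V} [G.LocallyFinite] {p : I}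
  {P : Measure Ω} {X : ℝ≥0 → Ω → Config V}

/-- A set that no vertex of it wants to leave keeps a constant spin up to any given time. -/
lemma IsIsingModel.ae_agree [IsProbabilityMeasure P] (hX : IsIsingModel G p P X)
    {S : Finset V} (hS : ∀ u ∈ S, degIn G (S : Set V)ᶜ u < degIn G (S : Set V) u) (e : ℤˣ) (t : ℝ≥0) :
    ∀ᵐ ω ∂P, (∀ u ∈ S, X 0 ω u = e) → ∀ u ∈ S, X t ω u = e := by
  set f := agreeIndicator S e
  set A : Set Ω := X 0 ⁻¹' {η | ∀ u ∈ S, η u = e}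
  have hM := hX.martingale f (isLocal_agreeIndicator S e)
  have hA0 : MeasurableSet[pastFiltration X hX.measurable 0] A :=
    le_iSup₂ (f := fun s (_ : s ≤ (0 : ℝ≥0)) => MeasurableSpace.comap (X s) inferInstance) 0 le_rfl
      _ ⟨_, measurableSet_agree S e, rfl⟩
  have hAm : MeasurableSet A := (pastFiltration X hX.measurable).le 0 _ hA0
  have hfm : Measurable f := measurable_one.indicator (measurableSet_agree S e)
  have hf0 : ∀ η, 0 ≤ f η := fun η => Set.indicator_nonneg (fun _ _ => zero_le_one) _
  have hf1 : ∀ η, f η ≤ 1 := fun η => Set.indicator_le_self' (fun _ _ => zero_le_one) _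
  have hint : Integrable (fun ω => f (X t ω)) P :=
    Integrable.of_bound (hfm.comp (hX.measurable t)).aestronglyMeasurable 1
      (ae_of_all _ fun ω => by rw [Real.norm_of_nonneg (hf0 _)]; exact hf1 _)
  have h0 := hM.setIntegral_eq (zero_le : 0 ≤ t) hA0
  simp only [sub_self, NNReal.coe_zero, intervalIntegral.integral_same, integral_zero] at h0
  -- On `A` the martingale at time `t` is at most `f (X t ω) - 1`, and its integral over `A` equals
  -- its initial value 0.
  have hle : 0 ≤ ∫ ω in A, (f (X t ω) - 1) ∂P := by
    rw [h0]
    refine setIntegral_mono_on (hM.integrable t).integrableOn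
      (hint.sub (integrable_const 1)).integrableOn hAm fun ω hω => ?_
    have h1 : f (X 0 ω) = 1 :=
      Set.indicator_of_mem (s := {η : Config V | ∀ u ∈ S, η u = e}) hω _
    have h2 : 0 ≤ ∫ s in (0 : ℝ)..t, generator G f (X s.toNNReal ω) :=
      intervalIntegral.integral_nonneg t.2 fun s _ => generator_agreeIndicator_nonneg G hS e _
    rw [h1]
    linarith
  have hz : ∫ ω in A, (1 - f (X t ω)) ∂P = 0 := by
    refine le_antisymm ?_ (integral_nonneg fun ω => sub_nonneg.2 (hf1 _))
    have : ∫ ω in A, (1 - f (X t ω)) ∂P = -∫ ω in A, (f (X t ω) - 1) ∂P := by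
      rw [← integral_neg]
      simp
    linarith
  rw [setIntegral_eq_zero_iff_of_nonneg_ae (ae_of_all _ fun ω => sub_nonneg.2 (hf1 _))
    ((integrable_const 1).sub hint).integrableOn, Filter.EventuallyEq,
    ae_restrict_iff' hAm] at hz
  filter_upwards [hz] with ω hω h
  by_contra hne
  have h1 := hω h
  have h2 : f (X t ω) = 0 :=
    Set.indicator_of_notMem (s := {η : Config V | ∀ u ∈ S, η u = e}) hne _
  simp [h2] at h1

/-- Null sets are discarded only for a countable dense set of times. A spin different from `e` at
time `t` would persist on some `[t, r)`, which contains a dense time. -/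
lemma IsIsingModel.ae_forall_agree [IsProbabilityMeasure P] (hX : IsIsingModel G p P X)
    {S : Finset V} (hS : ∀ u ∈ S, degIn G (S : Set V)ᶜ u < degIn G (S : Set V) u) (e : ℤˣ) :
    ∀ᵐ ω ∂P, (∀ u ∈ S, X 0 ω u = e) → ∀ u ∈ S, ∀ t, X t ω u = e := by
  obtain ⟨D, hDc, hD⟩ := TopologicalSpace.exists_countable_dense ℝ≥0
  filter_upwards [(ae_ball_iff hDc).2 fun t _ => hX.ae_agree hS e t] with ω hω h u hu t
  by_contra hne
  have hc : ContinuousWithinAt (fun s => X s ω u) (Set.Ici t) t :=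
    (continuous_apply u).continuousAt.comp_continuousWithinAt (hX.right_continuous ω t)
  have hev : ∀ᶠ s in 𝓝[≥] t, X s ω u ≠ e := hc ((isOpen_discrete {e}ᶜ).mem_nhds hne)
  obtain ⟨r, hr, hsub⟩ := mem_nhdsGE_iff_exists_Ico_subset.1 hev
  obtain ⟨s, hsD, hs⟩ := hD.exists_between hr
  exact hsub ⟨hs.1.le, hs.2⟩ (hω s hsD h u hu)

lemma IsIsingModel.measure_initial_agree (hX : IsIsingModel G p P X) (S : Finset V) (e : ℤˣ) :
    P {ω | ∀ u ∈ S, X 0 ω u = e} = bernoulliMeasure (1 : ℤˣ) (-1) p {e} ^ S.card := by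
  have h := Measure.map_apply (μ := P) (hX.measurable 0) (measurableSet_agree S e)
  rw [hX.initial_law] at h
  have : {η : Config V | ∀ u ∈ S, η u = e} = Set.pi (S : Set V) fun _ => {e} := by
    ext; simp [Set.mem_pi]
  rw [this, Measure.infinitePi_pi _ (fun _ _ => MeasurableSet.of_discrete),
    Finset.prod_const, ← this] at h
  exact h.symm

lemma IsIsingModel.pow_le_measure_forall_agree [IsProbabilityMeasure P] (hX : IsIsingModel G p P X)
    {S : Finset V} (hS : ∀ u ∈ S, degIn G (S : Set V)ᶜ u < degIn G (S : Set V) u) (e : ℤˣ) :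
    bernoulliMeasure (1 : ℤˣ) (-1) p {e} ^ S.card ≤ P {ω | ∀ u ∈ S, ∀ t, X t ω u = e} := by
  rw [← hX.measure_initial_agree S e]
  exact measure_mono_ae (hX.ae_forall_agree hS e)

end Model

lemma flipTimes_eq_empty {V : Type*} {x : ℝ≥0 → Config V} {v : V} {e : ℤˣ}
    (h : ∀ t, x t v = e) : flipTimes x v = ∅ := by
  refine Set.eq_empty_of_forall_notMem fun t ht => ?_
  -- At `t = 0` the left-limit condition would be vacuous; `0 < t` excludes this.
  have : (𝓝[<] t).NeBot := nhdsLT_neBot_of_exists_lt ⟨0, ht.1⟩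
  obtain ⟨s, hs⟩ := ht.2.exists
  rw [h, h] at hs
  exact units_ne_neg_self e hs

/-- Covers the endpoints `p = 0` and `p = 1`, where only one spin has positive mass. -/
lemma exists_bernoulliMeasure_singleton_ne_zero (p : I) :
    ∃ e : ℤˣ, bernoulliMeasure (1 : ℤˣ) (-1) p {e} ≠ 0 := by
  by_contra! h
  have h1 : bernoulliMeasure (1 : ℤˣ) (-1) p Set.univ = 0 := by
    rw [← Set.iUnion_of_singleton, measure_iUnion_null_iff]
    exact h
  simp at h1

end ZeroTempIsing

theorem mainTheorem3 {V : Type*} [Countable V] (G : SimpleGraph V) [G.LocallyFinite]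
    (hdeg : BddAbove (Set.range fun v => G.degree v))
    (hG : ¬ ZeroTempIsing.HasShrinkProperty G) (p : I)
    {Ω : Type*} [MeasurableSpace Ω] (P : Measure Ω) [IsProbabilityMeasure P]
    (X : ℝ≥0 → Ω → ZeroTempIsing.Config V) (hX : ZeroTempIsing.IsIsingModel G p P X) :
    ¬ ZeroTempIsing.IsTypeI P X ∧
      ∀ S : Finset V,
        (∀ u ∈ S, ZeroTempIsing.degIn G (S : Set V)ᶜ u < ZeroTempIsing.degIn G (S : Set V) u) →
          ENNReal.ofReal ((p : ℝ) ^ S.card) ≤ P {ω | ∀ u ∈ S, ∀ t, X t ω u = 1} := by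
  refine ⟨fun hI => ?_, fun S hS => ?_⟩
  · simp only [ZeroTempIsing.HasShrinkProperty, not_forall, not_exists, not_and, not_le] at hG
    obtain ⟨T, hfin, ⟨v, hv⟩, hT⟩ := hG
    lift T to Finset V using hfin
    obtain ⟨e, he⟩ := ZeroTempIsing.exists_bernoulliMeasure_singleton_ne_zero p
    have hpos := (pos_iff_ne_zero.2 (pow_ne_zero _ he)).trans_le (hX.pow_le_measure_forall_agree hT e)
    refine hpos.ne' (measure_mono_null ?_ (ae_iff.1 hI))
    intro ω hω hinf
    exact (hinf v).nonempty.ne_empty (ZeroTempIsing.flipTimes_eq_empty (hω v hv))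
  · refine le_trans (le_of_eq ?_) (hX.pow_le_measure_forall_agree hS 1)
    rw [ENNReal.ofReal_pow p.2.1]
    congr 1
    rw [bernoulliMeasure_apply_of_mem_of_notMem p MeasurableSet.of_discrete (by simp) (by decide)]
    exact ENNReal.ofReal_eq_coe_nnreal p.2.1
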